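/- Let $K$ be a field, $n,k\ge 0$, and let $\prec$ be a degree-compatible term ordering on the set $\mathcal T_n$ of terms of $K[X]=K[x_1,\dots,x_n]$ (that is, $\deg s<\deg t$ implies $s\prec t$). Let $F=(f_1,\dots,f_r)$ be a finite list of polynomials such that the ideal $I=\langle F\rangle$ is zero-dimensional, i.e. only finitely many terms are not leading terms of nonzero elements of $I$. The oracle border basis algorithm (OBBA) with budget $k$ works as follows. Put $d=\max_i\deg f_i$ ($d=0$ if $F$ is empty), and let $\mathcal V$ be a basis of the $K$-span of $F$ with pairwise distinct leading terms, obtained by Gaussian elimination. Repeat the following iteration, where $\mathcal L=\{t\in\mathcal T_n:\deg t\le d\}$. 1. Choose the candidates $\mathcal C$. If the oracle has been invoked fewer than $k$ times so far and the invocation rule asks for it, then invoke the oracle: it returns a list of pairs (variable $x_\ell$, term $t$), and $\mathcal C$ consists of the products $x_\ell p$ with $p\in\mathcal V$ of leading term $t$. Otherwise make a full expansion: $\mathcal C=\mathcal V^+=\{x_jv: v\in\mathcal V,\ 1\le j\le n\}$. 2. $\mathcal V'=\mathrm{BasisExtension}(\mathcal V,\mathcal C,\mathcal L)$: extend $\mathcal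 V$ by Gaussian elimination to a basis, with pairwise distinct leading terms, of the span of $\mathcal V\cup\mathcal C$, and keep the basis elements all of whose terms lie in $\mathcal L$. 3. If $\mathcal V'\ne\mathcal V$, replace $\mathcal V$ by $\mathcal V'$ and start the next iteration. 4. Otherwise let $\mathcal O=\mathcal L\setminus\mathrm{LT}(\mathcal V)$, with border $\partial\mathcal O=(x_1\mathcal O\cup\dots\cup x_n\mathcal O)\setminus\mathcal O$. If $\partial\mathcal O\not\subseteq\mathcal L$, replace $d$ by $d+1$ and start the next iteration. If $\partial\mathcal O\subseteq\mathcal L$ and the oracle was used in this iteration, start the next iteration. If $\partial\mathcal O\subseteq\mathcal L$ and the expansion was full, leave the loop. After the loop, $\mathrm{FinalReduction}$ runs through $\mathcal V$ by increasing leading terms, eliminates from each polynomial the leading terms of those already treated, makes it monic, and finally returns the polynomials whose leading terms lie in $\partial\mathcal O$. Then, for every oracle and every invocation rule (both may depend arbitrarily on the number of the iteration, on $\mathcal L$ and on $\mathcal V$), the algorithm terminates. If moreover $I\ne K[X]$, its output $G$ is a border basis of $I$: there is an order ideal $\mathcal O$ (a finite set of terms closed under taking divisors) such that $G=\{g_b: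 b\in\partial\mathcal O\}$ with $g_b=b-\sum_{t\in\mathcal O}c_{b,t}\,t$, $c_{b,t}\in K$, such that $G$ generates $I$, and such that $K[X]=I\oplus\langle\mathcal O\rangle_K$, where $\langle\mathcal O\rangle_K$ is the $K$-span of $\mathcal O$. -/

import Mathlib

namespace OBBA

open MvPolynomial

noncomputable section

/-- Terms `x₁^{a₁} ⋯ xₙ^{aₙ}`, represented by their exponent vectors. -/
abbrev Term (n : ℕ) := Fin n →₀ ℕ

/-! ### Order ideals and border bases -/

/-- A finite set of terms that is closed under taking divisors. -/
def IsOrderIdeal {n : ℕ} (O : Set (Term n)) : Prop :=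
  O.Finite ∧ ∀ o ∈ O, ∀ t : Term n, t ≤ o → t ∈ O

/-- The border `∂O = (x₁O ∪ ⋯ ∪ xₙO) \ O`. -/
def border {n : ℕ} (O : Set (Term n)) : Set (Term n) :=
  {t | (∃ j : Fin n, ∃ o ∈ O, t = o + Finsupp.single j 1) ∧ t ∉ O}

/-- The vector space `⟨O⟩_K` spanned by a set of terms. -/
def termSpan {n : ℕ} (K : Type*) [Field K] (O : Set (Term n)) :
    Submodule K (MvPolynomial (Fin n) K) :=
  Submodule.span K ((fun t => monomial t (1 : K)) '' O)

/-- `G = {g_b | b ∈ ∂O}` with `g_b = b - ∑_{t ∈ O} c_t t`. -/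
def IsBorderPrebasis {n : ℕ} {K : Type*} [Field K] (O : Set (Term n))
    (G : Set (MvPolynomial (Fin n) K)) : Prop :=
  ∃ g : Term n → MvPolynomial (Fin n) K,
    (∀ b ∈ border O, monomial b (1 : K) - g b ∈ termSpan K O) ∧ G = g '' border O

/-- `G` is the `O`-border basis of the ideal `I`: `O` is an order ideal, `G` is an `O`-border
prebasis that generates `I`, and `K[X] = I ⊕ ⟨O⟩_K`. -/
def IsBorderBasis {n : ℕ} {K : Type*} [Field K] (O : Set (Term n))
    (G : Set (MvPolynomial (Fin n) K)) (I : Ideal (MvPolynomial (Fin n) K)) : Prop :=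
  IsOrderIdeal O ∧ IsBorderPrebasis O G ∧ Ideal.span G = I ∧
    IsCompl (I.restrictScalars K) (termSpan K O)

/-! ### Term orderings and zero-dimensional ideals -/

/-- The term ordering `m` refines the comparison of total degrees. -/
def DegreeCompatible {n : ℕ} (m : MonomialOrder (Fin n)) : Prop :=
  ∀ s t : Term n, s.degree < t.degree → m.toSyn s < m.toSyn t

/-- Only finitely many terms are not leading terms of nonzero elements of `I`. -/
def IsZeroDimensional {n : ℕ} {K : Type*} [Field K] (m : MonomialOrder (Fin n))
    (I : Ideal (MvPolynomial (Fin n) K)) : Prop :=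
  {t : Term n | ¬ ∃ f ∈ I, f ≠ 0 ∧ m.degree f = t}.Finite

/-! ### The subroutines of the algorithm

Generator sets are finite lists of polynomials. The leading term of `f` is `m.degree f`. -/

section Subroutines

variable {n : ℕ} {K : Type*} [Field K] (m : MonomialOrder (Fin n))

/-- The computational universe: all terms of degree at most `d`. -/
def termsUpTo (n d : ℕ) : Set (Term n) := {t | t.degree ≤ d}

/-- Subtract the multiple of `v` from `g` that removes the leading term of `v` from `g`. -/
def eliminate (g v : MvPolynomial (Fin n) K) : MvPolynomial (Fin n) K :=
  g - C (g.coeff (m.degree v) / m.leadingCoeff v) * v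

/-- Divide by the leading coefficient. -/
def normalize (g : MvPolynomial (Fin n) K) : MvPolynomial (Fin n) K :=
  C (m.leadingCoeff g)⁻¹ * g

/-- Sort by decreasing leading terms. -/
def sortDesc (V : List (MvPolynomial (Fin n) K)) : List (MvPolynomial (Fin n) K) :=
  V.insertionSort (fun f g => m.toSyn (m.degree g) ≤ m.toSyn (m.degree f))

/-- Sort by increasing leading terms. -/
def sortAsc (V : List (MvPolynomial (Fin n) K)) : List (MvPolynomial (Fin n) K) :=
  V.insertionSort (fun f g => m.toSyn (m.degree f) ≤ m.toSyn (m.degree g))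

/-- Reduce `g` modulo `V`: eliminate the leading terms of `V`, from the largest to the smallest. -/
def reduceBy (V : List (MvPolynomial (Fin n) K)) (g : MvPolynomial (Fin n) K) :
    MvPolynomial (Fin n) K :=
  (sortDesc m V).foldl (eliminate m) g

open Classical in
/-- One step of Gaussian elimination: reduce `g` modulo `V` and, unless the result is zero, append
the normalized result. -/
def gaussStep (V : List (MvPolynomial (Fin n) K)) (g : MvPolynomial (Fin n) K) :
    List (MvPolynomial (Fin n) K) :=
  if reduceBy m V g = 0 then V else V ++ [normalize m (reduceBy m V g)]

/-- Gaussian elimination: extend `V` to a basis, with pairwise distinct leading terms, of the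
vector space spanned by `V` and `C`. -/
def gaussExtend (V C : List (MvPolynomial (Fin n) K)) : List (MvPolynomial (Fin n) K) :=
  C.foldl (gaussStep m) V

/-- A basis of `⟨F⟩_K` with pairwise distinct leading terms. -/
def vectorSpaceBasis (F : List (MvPolynomial (Fin n) K)) : List (MvPolynomial (Fin n) K) :=
  gaussExtend m [] F

open Classical in
/-- `BasisExtension(V, C, L)`: extend `V` by Gaussian elimination with the candidates `C`, and keep
the polynomials all of whose terms lie in `L`. -/
def basisExtension (V C : List (MvPolynomial (Fin n) K)) (L : Set (Term n)) :
    List (MvPolynomial (Fin n) K) :=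
  (gaussExtend m V C).filter (fun f => ∀ t ∈ f.support, t ∈ L)

/-- The full expansion `V⁺ = {x_j v | v ∈ V, 1 ≤ j ≤ n}`. -/
def fullExpansion (V : List (MvPolynomial (Fin n) K)) : List (MvPolynomial (Fin n) K) :=
  V.flatMap (fun v => (List.finRange n).map (fun j => X j * v))

open Classical in
/-- The candidates selected by a list of pairs (variable `x_j`, term `t`): all `x_j p` with `p ∈ V`
of leading term `t`. Pairs whose term is no leading term of `V` select nothing. -/
def selectCandidates (V : List (MvPolynomial (Fin n) K)) (P : List (Fin n × Term n)) :
    List (MvPolynomial (Fin n) K) :=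
  P.flatMap (fun q => (V.filter (fun p => m.degree p = q.2)).map (fun p => X q.1 * p))

/-- The tentative order ideal `L \ LT(V)`. -/
def tentativeOrderIdeal (L : Set (Term n)) (V : List (MvPolynomial (Fin n) K)) :
    Set (Term n) :=
  {t | t ∈ L ∧ ∀ v ∈ V, m.degree v ≠ t}

/-- The border of the tentative order ideal is contained in `L`. -/
def BorderBasisCheck (L : Set (Term n)) (V : List (MvPolynomial (Fin n) K)) : Prop :=
  border (tentativeOrderIdeal m L V) ⊆ L

/-- Run through `V` by increasing leading terms, eliminate from each polynomial the leading terms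
of the polynomials already treated, and normalize. -/
def interreduce (V : List (MvPolynomial (Fin n) K)) : List (MvPolynomial (Fin n) K) :=
  (sortAsc m V).foldl (fun R v => R ++ [normalize m (R.foldl (eliminate m) v)]) []

open Classical in
/-- `FinalReduction(V, L)`: interreduce, and return the polynomials with leading term in the border
of `L \ LT(V)`. -/
def finalReduction (V : List (MvPolynomial (Fin n) K)) (L : Set (Term n)) :
    List (MvPolynomial (Fin n) K) :=
  (interreduce m V).filter (fun g => m.degree g ∈ border (tentativeOrderIdeal m L V))

end Subroutines

/-! ### The oracle border basis algorithm -/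

/-- An oracle, and a rule that says when it is to be invoked. Both see the number of the current
iteration, the universe and the generator set; nothing is assumed about their answers. -/
structure Oracle (n : ℕ) (K : Type*) [Field K] where
  invoke : ℕ → Set (Term n) → List (MvPolynomial (Fin n) K) → Prop
  predict : ℕ → Set (Term n) → List (MvPolynomial (Fin n) K) → List (Fin n × Term n)

/-- The state at the head of the main loop: number of completed iterations, number of oracle calls
made so far, degree `d` of the universe `L`, generator set `V`. -/
structure State (n : ℕ) (K : Type*) [Field K] where
  iter : ℕ
  calls : ℕ
  d : ℕ
  V : List (MvPolynomial (Fin n) K)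

/-- The initial state: `d = max deg f_i` and `V` a basis of `⟨F⟩_K`. -/
def initialState {n : ℕ} {K : Type*} [Field K] (m : MonomialOrder (Fin n))
    (F : List (MvPolynomial (Fin n) K)) : State n K where
  iter := 0
  calls := 0
  d := (F.map MvPolynomial.totalDegree).foldr max 0
  V := vectorSpaceBasis m F

/-- The oracle replaces the full expansion in this iteration: it is invoked, and at most `k - 1`
calls have been made before. -/
def UsesOracle {n : ℕ} {K : Type*} [Field K] (A : Oracle n K) (k : ℕ) (s : State n K) : Prop :=
  s.calls < k ∧ A.invoke s.iter (termsUpTo n s.d) s.V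

open Classical in
/-- The candidate set `C` of the current iteration. -/
def candidates {n : ℕ} {K : Type*} [Field K] (m : MonomialOrder (Fin n)) (A : Oracle n K)
    (k : ℕ) (s : State n K) : List (MvPolynomial (Fin n) K) :=
  if UsesOracle A k s then
    selectCandidates m s.V (A.predict s.iter (termsUpTo n s.d) s.V)
  else fullExpansion s.V

open Classical in
/-- One iteration of the main loop: either the next state or, when the loop is left, the output.
The loop may be left only after a full expansion without new generators. -/
def step {n : ℕ} {K : Type*} [Field K] (m : MonomialOrder (Fin n)) (A : Oracle n K) (k : ℕ)
    (s : State n K) : State n K ⊕ List (MvPolynomial (Fin n) K) :=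
  let L := termsUpTo n s.d
  let V' := basisExtension m s.V (candidates m A k s) L
  let calls' := if UsesOracle A k s then s.calls + 1 else s.calls
  if V' ≠ s.V then
    Sum.inl ⟨s.iter + 1, calls', s.d, V'⟩
  else if ¬ BorderBasisCheck m L s.V then
    Sum.inl ⟨s.iter + 1, calls', s.d + 1, s.V⟩
  else if UsesOracle A k s then
    Sum.inl ⟨s.iter + 1, calls', s.d, s.V⟩
  else
    Sum.inr (finalReduction m s.V L)

/-- The output reached from the state `s` within at most `N` iterations, if there is one. -/
def runFor {n : ℕ} {K : Type*} [Field K] (m : MonomialOrder (Fin n)) (A : Oracle n K) (k : ℕ) :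
    ℕ → State n K → Option (List (MvPolynomial (Fin n) K))
  | 0, _ => none
  | N + 1, s =>
    match step m A k s with
    | Sum.inl s' => runFor m A k N s'
    | Sum.inr G => some G

/-- The algorithm with input `F` stops after finitely many iterations and returns `G`. -/
def Returns {n : ℕ} {K : Type*} [Field K] (m : MonomialOrder (Fin n)) (A : Oracle n K) (k : ℕ)
    (F G : List (MvPolynomial (Fin n) K)) : Prop :=
  ∃ N : ℕ, runFor m A k N (initialState m F) = some G

end

end OBBA

namespace OBBA

open MvPolynomial
open scoped IsMulCommutative

noncomputable section

/-! Correctness. The loop is left only when `V` is stable: `⟨V⟩` contains every element of `⟨V⁺⟩` of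
degree at most `d`. With `O = L \ LT(V)`, linear algebra gives `⟨L⟩ = ⟨V⟩ ⊕ ⟨O⟩`, and the check `∂O
⊆ L` says that `x_j⟨O⟩ ⊆ ⟨L⟩`. Multiplying by `x_j` and projecting back to `⟨O⟩` along `⟨V⟩` yields
formal multiplication maps, which commute because `V` is stable. So `⟨O⟩` becomes a `K[X]`-module in
which `f ∈ ⟨L⟩` sends `1` to the projection of `f`. Elements of `I` kill `1`, while `f ∈ ⟨O⟩` sends
`1` to `f`; hence `I ∩ ⟨O⟩ = 0` (`disjoint_ideal_span`). Rewriting border terms gives `(G) + ⟨O⟩ =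
K[X]` (`IsBorderPrebasis.sup_eq_top`), and the two facts force `(G) = I`. Both need `1 ∈ O`, which
is what `I ≠ K[X]` provides. The oracle cannot do harm: its candidates lie in `I`, and the exit
requires a full expansion.

Termination. At most `k` iterations use the oracle. Any other iteration that stays in the loop
enlarges `V` inside the finite universe or raises `d`. After a full expansion `d` is raised only
below a fixed bound, since in high degrees every stable `V` passes the check
(`exists_bound_borderBasisCheck`).

Degree compatibility enters through `basisExtension_spec`: discarding basis elements that leave `L`
loses nothing of the span inside `⟨L⟩`. -/

variable {n : ℕ} {K : Type*} [Field K] {m : MonomialOrder (Fin n)}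

/-- The vector space spanned by the members of a list. -/
abbrev listSpan (V : List (MvPolynomial (Fin n) K)) : Submodule K (MvPolynomial (Fin n) K) :=
  Submodule.span K {f | f ∈ V}

lemma listSpan_append (V W : List (MvPolynomial (Fin n) K)) :
    listSpan (V ++ W) = listSpan V ⊔ listSpan W := by
  rw [listSpan, listSpan, listSpan, ← Submodule.span_union]
  congr 1
  ext f
  simp

lemma listSpan_singleton (f : MvPolynomial (Fin n) K) :
    listSpan [f] = Submodule.span K {f} := by
  simp [listSpan]

lemma listSpan_cons (f : MvPolynomial (Fin n) K) (V : List (MvPolynomial (Fin n) K)) :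
    listSpan (f :: V) = Submodule.span K {f} ⊔ listSpan V := by
  rw [← List.singleton_append, listSpan_append, listSpan_singleton]

lemma listSpan_perm {V W : List (MvPolynomial (Fin n) K)} (h : V.Perm W) :
    listSpan V = listSpan W := by
  simp only [listSpan, h.mem_iff]

/-! ### Spans of terms -/

lemma mem_termSpan_iff {O : Set (Term n)} {f : MvPolynomial (Fin n) K} :
    f ∈ termSpan K O ↔ ∀ t ∈ f.support, t ∈ O := by
  constructor
  · intro hf
    induction hf using Submodule.span_induction with
    | mem x hx =>
      obtain ⟨t, ht, rfl⟩ := hx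
      intro s hs
      have := Finset.mem_of_subset support_monomial_subset hs
      simp only [Finset.mem_singleton] at this
      exact this ▸ ht
    | zero => simp
    | add x y _ _ hx hy =>
      classical
      intro t ht
      rcases Finset.mem_union.mp (support_add ht) with h | h
      exacts [hx t h, hy t h]
    | smul a x _ hx => exact fun t ht => hx t (support_smul ht)
  · intro h
    rw [f.as_sum]
    refine Submodule.sum_mem _ fun t ht => ?_
    have : monomial t (coeff t f) = coeff t f • monomial t (1 : K) := by
      simp [smul_monomial]
    rw [this]
    exact Submodule.smul_mem _ _ (Submodule.subset_span ⟨t, h t ht, rfl⟩)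

lemma monomial_mem_termSpan {O : Set (Term n)} {t : Term n} (ht : t ∈ O) :
    monomial t (1 : K) ∈ termSpan K O :=
  Submodule.subset_span ⟨t, ht, rfl⟩

lemma support_degree_le (hm : DegreeCompatible m) {f : MvPolynomial (Fin n) K} {t : Term n}
    (ht : t ∈ f.support) : t.degree ≤ (m.degree f).degree := by
  by_contra! h
  exact absurd (m.le_degree ht) (not_le.mpr (hm _ _ h))

lemma mem_termSpan_termsUpTo (hm : DegreeCompatible m) {f : MvPolynomial (Fin n) K} {d : ℕ}
    (h : (m.degree f).degree ≤ d) : f ∈ termSpan K (termsUpTo n d) :=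
  mem_termSpan_iff.mpr fun _ ht => (support_degree_le hm ht).trans h

lemma degree_degree_le {f : MvPolynomial (Fin n) K} {d : ℕ}
    (h : f ∈ termSpan K (termsUpTo n d)) : (m.degree f).degree ≤ d := by
  by_cases hf : f = 0
  · simp [hf]
  · exact mem_termSpan_iff.mp h _ (m.degree_mem_support hf)

lemma termSpan_termsUpTo_mono {d e : ℕ} (h : d ≤ e) :
    termSpan K (termsUpTo n d) ≤ termSpan K (termsUpTo n e) :=
  Submodule.span_mono (Set.image_mono fun _ ht => le_trans ht h)

lemma mul_mem_termSpan {f g : MvPolynomial (Fin n) K} {d e : ℕ}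
    (hf : f ∈ termSpan K (termsUpTo n d)) (hg : g ∈ termSpan K (termsUpTo n e)) :
    f * g ∈ termSpan K (termsUpTo n (d + e)) := by
  classical
  rw [mem_termSpan_iff] at *
  intro t ht
  obtain ⟨a, ha, b, hb, rfl⟩ := Finset.mem_add.mp (support_mul f g ht)
  have h1 : a.degree ≤ d := hf a ha
  have h2 : b.degree ≤ e := hg b hb
  change (a + b).degree ≤ d + e
  rw [map_add]
  omega

lemma exists_mem_termSpan (f : MvPolynomial (Fin n) K) :
    ∃ d, f ∈ termSpan K (termsUpTo n d) := by
  refine ⟨f.support.sup Finsupp.degree, mem_termSpan_iff.mpr fun t ht => ?_⟩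
  exact Finset.le_sup (f := Finsupp.degree) ht

/-! ### Elimination -/

lemma coeff_eliminate (t : Term n) (g v : MvPolynomial (Fin n) K) :
    coeff t (eliminate m g v) =
      coeff t g - coeff (m.degree v) g / m.leadingCoeff v * coeff t v := by
  simp [eliminate]

lemma coeff_degree_eliminate {g v : MvPolynomial (Fin n) K} (hv : v ≠ 0) :
    coeff (m.degree v) (eliminate m g v) = 0 := by
  have h : m.leadingCoeff v ≠ 0 := m.leadingCoeff_ne_zero_iff.mpr hv
  rw [coeff_eliminate]
  change _ - _ / m.leadingCoeff v * m.leadingCoeff v = 0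
  rw [div_mul_cancel₀ _ h, sub_self]

lemma coeff_foldl_eliminate (t : Term n) (R : List (MvPolynomial (Fin n) K))
    (h : ∀ v ∈ R, coeff t v = 0) (g : MvPolynomial (Fin n) K) :
    coeff t (R.foldl (eliminate m) g) = coeff t g := by
  induction R generalizing g with
  | nil => rfl
  | cons v R ih =>
    rw [List.foldl_cons, ih (fun w hw => h w (List.mem_cons_of_mem _ hw)), coeff_eliminate,
      h v List.mem_cons_self, mul_zero, sub_zero]

/-- A coefficient, once cleared, stays cleared: the polynomials subtracted later do not contain that
term. Only this one direction of the pairwise condition is needed, so the lemma serves both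
decreasingly sorted lists and interreduced ones. -/
lemma coeff_degree_foldl_eliminate (R : List (MvPolynomial (Fin n) K))
    (h0 : ∀ v ∈ R, v ≠ 0) (h : R.Pairwise fun v w => coeff (m.degree v) w = 0)
    (g : MvPolynomial (Fin n) K) :
    ∀ v ∈ R, coeff (m.degree v) (R.foldl (eliminate m) g) = 0 := by
  induction R generalizing g with
  | nil => simp
  | cons v R ih =>
    rw [List.pairwise_cons] at h
    intro w hw
    rw [List.foldl_cons]
    rcases List.mem_cons.mp hw with rfl | hw
    · rw [coeff_foldl_eliminate _ _ h.1, coeff_degree_eliminate (h0 _ List.mem_cons_self)]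
    · exact ih (fun u hu => h0 u (List.mem_cons_of_mem _ hu)) h.2 _ w hw

lemma sub_eliminate_mem (g v : MvPolynomial (Fin n) K) :
    g - eliminate m g v ∈ Submodule.span K {v} := by
  rw [eliminate, sub_sub_cancel, ← smul_eq_C_mul]
  exact Submodule.smul_mem _ _ (Submodule.mem_span_singleton_self v)

lemma sub_foldl_eliminate_mem (R : List (MvPolynomial (Fin n) K)) (g : MvPolynomial (Fin n) K) :
    g - R.foldl (eliminate m) g ∈ listSpan R := by
  induction R generalizing g with
  | nil => simp
  | cons v R ih =>
    rw [List.foldl_cons, listSpan_cons, ← sub_add_sub_cancel g (eliminate m g v)]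
    exact Submodule.add_mem_sup (sub_eliminate_mem g v) (ih _)

/-! ### Lists with pairwise distinct leading terms -/

/-- The list consists of nonzero polynomials with pairwise distinct leading terms. -/
def Triangular (m : MonomialOrder (Fin n)) (V : List (MvPolynomial (Fin n) K)) : Prop :=
  (∀ v ∈ V, v ≠ 0) ∧ V.Pairwise fun v w => m.degree v ≠ m.degree w

lemma Triangular.perm {V W : List (MvPolynomial (Fin n) K)} (hV : Triangular m V)
    (h : V.Perm W) : Triangular m W :=
  ⟨fun v hv => hV.1 v (h.mem_iff.mpr hv), (h.pairwise_iff fun h => h.symm).mp hV.2⟩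

lemma sortDesc_perm (V : List (MvPolynomial (Fin n) K)) : (sortDesc m V).Perm V :=
  List.perm_insertionSort _ _

lemma sortAsc_perm (V : List (MvPolynomial (Fin n) K)) : (sortAsc m V).Perm V :=
  List.perm_insertionSort _ _

lemma Triangular.sortDesc_pairwise {V : List (MvPolynomial (Fin n) K)} (hV : Triangular m V) :
    (sortDesc m V).Pairwise fun v w => m.toSyn (m.degree w) < m.toSyn (m.degree v) := by
  have h1 : (sortDesc m V).Pairwise fun v w => m.toSyn (m.degree w) ≤ m.toSyn (m.degree v) := by
    have : Std.Total fun f g : MvPolynomial (Fin n) K =>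
        m.toSyn (m.degree g) ≤ m.toSyn (m.degree f) := ⟨fun a b => le_total _ _⟩
    have : IsTrans _ fun f g : MvPolynomial (Fin n) K =>
        m.toSyn (m.degree g) ≤ m.toSyn (m.degree f) := ⟨fun a b c h1 h2 => h2.trans h1⟩
    exact List.pairwise_insertionSort _ _
  refine (h1.and (hV.perm (sortDesc_perm V).symm).2).imp fun h => ?_
  exact lt_of_le_of_ne h.1 fun e => h.2 (m.toSyn.injective e).symm

lemma Triangular.sortAsc_pairwise {V : List (MvPolynomial (Fin n) K)} (hV : Triangular m V) :
    (sortAsc m V).Pairwise fun v w => m.toSyn (m.degree v) < m.toSyn (m.degree w) := by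
  have h1 : (sortAsc m V).Pairwise fun v w => m.toSyn (m.degree v) ≤ m.toSyn (m.degree w) := by
    have : Std.Total fun f g : MvPolynomial (Fin n) K =>
        m.toSyn (m.degree f) ≤ m.toSyn (m.degree g) := ⟨fun a b => le_total _ _⟩
    have : IsTrans _ fun f g : MvPolynomial (Fin n) K =>
        m.toSyn (m.degree f) ≤ m.toSyn (m.degree g) := ⟨fun a b c h1 h2 => h1.trans h2⟩
    exact List.pairwise_insertionSort _ _
  refine (h1.and (hV.perm (sortAsc_perm V).symm).2).imp fun h => ?_
  exact lt_of_le_of_ne h.1 fun e => h.2 (m.toSyn.injective e)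

lemma coeff_degree_reduceBy {V : List (MvPolynomial (Fin n) K)} (hV : Triangular m V)
    (g : MvPolynomial (Fin n) K) :
    ∀ v ∈ V, coeff (m.degree v) (reduceBy m V g) = 0 := by
  intro v hv
  refine coeff_degree_foldl_eliminate _ (hV.perm (sortDesc_perm V).symm).1
    (hV.sortDesc_pairwise.imp fun h => m.coeff_eq_zero_of_lt h) g v ?_
  exact (sortDesc_perm V).mem_iff.mpr hv

lemma sub_reduceBy_mem (V : List (MvPolynomial (Fin n) K)) (g : MvPolynomial (Fin n) K) :
    g - reduceBy m V g ∈ listSpan V := by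
  rw [← listSpan_perm (sortDesc_perm (m := m) V)]
  exact sub_foldl_eliminate_mem _ _

/-- A nonzero element of the span of a triangular list has the leading term of a member, and is
spanned by the members whose leading terms are not larger. -/
lemma degree_of_mem_listSpan_sorted (V : List (MvPolynomial (Fin n) K)) (h0 : ∀ v ∈ V, v ≠ 0)
    (h : V.Pairwise fun v w => m.toSyn (m.degree w) < m.toSyn (m.degree v))
    {f : MvPolynomial (Fin n) K} (hf : f ∈ listSpan V) (hf0 : f ≠ 0) :
    (∃ v ∈ V, m.degree v = m.degree f) ∧
      f ∈ Submodule.span K {v | v ∈ V ∧ m.toSyn (m.degree v) ≤ m.toSyn (m.degree f)} := by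
  induction V generalizing f with
  | nil => simp [listSpan] at hf; exact absurd hf hf0
  | cons v V ih =>
    rw [List.pairwise_cons] at h
    have ih' := fun {g : MvPolynomial (Fin n) K} =>
      ih (fun w hw => h0 w (List.mem_cons_of_mem _ hw)) h.2 (f := g)
    have hf' := hf
    rw [listSpan_cons] at hf'
    obtain ⟨y, hy, z, hz, rfl⟩ := Submodule.mem_sup.mp hf'
    obtain ⟨c, rfl⟩ := Submodule.mem_span_singleton.mp hy
    by_cases hc : c = 0
    · subst hc
      rw [zero_smul, zero_add] at hf0 ⊢
      obtain ⟨⟨w, hw, e⟩, hz'⟩ := ih' hz hf0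
      refine ⟨⟨w, List.mem_cons_of_mem _ hw, e⟩, Submodule.span_mono ?_ hz'⟩
      exact fun u hu => ⟨List.mem_cons_of_mem _ hu.1, hu.2⟩
    -- The head has the largest leading term, so nothing in the tail can cancel it.
    · have e1 : m.degree (c • v) = m.degree v := m.degree_smul_of_isRegular
        (IsRegular.of_ne_zero hc)
      have e2 : m.degree (c • v + z) = m.degree v := by
        by_cases hz0 : z = 0
        · rw [hz0, add_zero, e1]
        · obtain ⟨⟨w, hw, e⟩, -⟩ := ih' hz hz0
          rw [m.degree_add_of_lt, e1]
          rw [e1, ← e]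
          exact h.1 w hw
      refine ⟨⟨v, List.mem_cons_self, e2.symm⟩, Submodule.span_mono ?_ hf⟩
      intro u hu
      refine ⟨hu, ?_⟩
      rw [e2]
      rcases List.mem_cons.mp hu with rfl | hu
      · exact le_rfl
      · exact (h.1 u hu).le

lemma Triangular.degree_of_mem_listSpan {V : List (MvPolynomial (Fin n) K)}
    (hV : Triangular m V) {f : MvPolynomial (Fin n) K} (hf : f ∈ listSpan V) (hf0 : f ≠ 0) :
    (∃ v ∈ V, m.degree v = m.degree f) ∧
      f ∈ Submodule.span K {v | v ∈ V ∧ m.toSyn (m.degree v) ≤ m.toSyn (m.degree f)} := by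
  have := degree_of_mem_listSpan_sorted _ (hV.perm (sortDesc_perm V).symm).1
    hV.sortDesc_pairwise (listSpan_perm (sortDesc_perm (m := m) V) ▸ hf) hf0
  simpa only [(sortDesc_perm V).mem_iff] using this

/-! ### Gaussian elimination -/

lemma degree_normalize (g : MvPolynomial (Fin n) K) : m.degree (normalize m g) = m.degree g := by
  by_cases hg : g = 0
  · simp [hg, normalize]
  · rw [normalize, ← smul_eq_C_mul]
    exact m.degree_smul_of_isRegular
      (IsRegular.of_ne_zero (inv_ne_zero (m.leadingCoeff_ne_zero_iff.mpr hg)))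

lemma normalize_ne_zero {g : MvPolynomial (Fin n) K} (hg : g ≠ 0) : normalize m g ≠ 0 := by
  rw [normalize, ← smul_eq_C_mul]
  exact smul_ne_zero (inv_ne_zero (m.leadingCoeff_ne_zero_iff.mpr hg)) hg

lemma coeff_normalize (t : Term n) (g : MvPolynomial (Fin n) K) :
    coeff t (normalize m g) = (m.leadingCoeff g)⁻¹ * coeff t g := by
  simp [normalize]

lemma span_normalize (g : MvPolynomial (Fin n) K) :
    Submodule.span K {normalize m g} = Submodule.span K {g} := by
  by_cases hg : g = 0
  · simp [hg, normalize]
  · rw [normalize, ← smul_eq_C_mul]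
    exact Submodule.span_singleton_smul_eq
      (inv_ne_zero (m.leadingCoeff_ne_zero_iff.mpr hg)).isUnit g

lemma sup_span_eq_of_sub_mem {W : Submodule K (MvPolynomial (Fin n) K)}
    {f g : MvPolynomial (Fin n) K} (h : f - g ∈ W) :
    W ⊔ Submodule.span K {f} = W ⊔ Submodule.span K {g} := by
  refine le_antisymm (sup_le le_sup_left ?_) (sup_le le_sup_left ?_) <;>
    rw [Submodule.span_singleton_le_iff_mem]
  · rw [← sub_add_cancel f g]
    exact Submodule.add_mem_sup h (Submodule.mem_span_singleton_self _)
  · rw [← sub_sub_cancel f g, sub_eq_neg_add]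
    exact Submodule.add_mem_sup (neg_mem h) (Submodule.mem_span_singleton_self _)

/-- A nonzero remainder has zero coefficient at every old leading term, so its own leading term is
new. The prefix property lets the equality test on lists detect growth of the span. -/
lemma gaussStep_spec {V : List (MvPolynomial (Fin n) K)} (hV : Triangular m V)
    (g : MvPolynomial (Fin n) K) :
    Triangular m (gaussStep m V g) ∧ V <+: gaussStep m V g ∧
      listSpan (gaussStep m V g) = listSpan V ⊔ Submodule.span K {g} := by
  have hs := sup_span_eq_of_sub_mem (sub_reduceBy_mem (m := m) V g)
  unfold gaussStep
  split_ifs with h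
  · refine ⟨hV, List.prefix_rfl, ?_⟩
    rw [hs, h]
    simp
  · refine ⟨⟨?_, ?_⟩, List.prefix_append _ _, ?_⟩
    · intro v hv
      rcases List.mem_append.mp hv with hv | hv
      · exact hV.1 v hv
      · rw [List.mem_singleton.mp hv]
        exact normalize_ne_zero h
    · rw [List.pairwise_append]
      refine ⟨hV.2, List.pairwise_singleton _ _, fun v hv w hw e => ?_⟩
      rw [List.mem_singleton.mp hw, degree_normalize] at e
      have := coeff_degree_reduceBy hV g v hv
      rw [e] at this
      exact h (m.coeff_degree_eq_zero_iff.mp this)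
    · rw [listSpan_append, listSpan_singleton, span_normalize, hs]

lemma gaussExtend_spec {V : List (MvPolynomial (Fin n) K)} (hV : Triangular m V)
    (C : List (MvPolynomial (Fin n) K)) :
    Triangular m (gaussExtend m V C) ∧ V <+: gaussExtend m V C ∧
      listSpan (gaussExtend m V C) = listSpan V ⊔ listSpan C := by
  induction C generalizing V with
  | nil => exact ⟨hV, List.prefix_rfl, by simp [gaussExtend, listSpan]⟩
  | cons g C ih =>
    obtain ⟨h1, h2, h3⟩ := gaussStep_spec hV g
    obtain ⟨i1, i2, i3⟩ := ih h1
    refine ⟨i1, h2.trans i2, ?_⟩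
    rw [listSpan_cons, ← sup_assoc, ← h3]
    exact i3

lemma triangular_nil : Triangular m ([] : List (MvPolynomial (Fin n) K)) :=
  ⟨by simp, List.Pairwise.nil⟩

lemma vectorSpaceBasis_spec (F : List (MvPolynomial (Fin n) K)) :
    Triangular m (vectorSpaceBasis m F) ∧ listSpan (vectorSpaceBasis m F) = listSpan F := by
  obtain ⟨h1, -, h3⟩ := gaussExtend_spec (triangular_nil (m := m)) F
  exact ⟨h1, h3.trans (by simp [listSpan])⟩

lemma mem_basisExtension {V C : List (MvPolynomial (Fin n) K)} {L : Set (Term n)}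
    {f : MvPolynomial (Fin n) K} :
    f ∈ basisExtension m V C L ↔ f ∈ gaussExtend m V C ∧ f ∈ termSpan K L := by
  simp [basisExtension, mem_termSpan_iff]

/-- An element of the span uses only basis elements with leading terms not above its own. By degree
compatibility these stay within degree `d` if it does, so filtering the basis computes exactly the
intersection with `⟨L⟩`. -/
lemma basisExtension_spec (hm : DegreeCompatible m) {V : List (MvPolynomial (Fin n) K)}
    (hV : Triangular m V) (C : List (MvPolynomial (Fin n) K)) {d : ℕ}
    (hL : listSpan V ≤ termSpan K (termsUpTo n d)) :
    Triangular m (basisExtension m V C (termsUpTo n d)) ∧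
      V <+: basisExtension m V C (termsUpTo n d) ∧
      listSpan (basisExtension m V C (termsUpTo n d)) =
        (listSpan V ⊔ listSpan C) ⊓ termSpan K (termsUpTo n d) := by
  classical
  obtain ⟨h1, h2, h3⟩ := gaussExtend_spec hV C
  refine ⟨⟨?_, ?_⟩, ?_, le_antisymm (le_inf ?_ ?_) ?_⟩
  · exact fun v hv => h1.1 v (mem_basisExtension.mp hv).1
  · exact h1.2.sublist List.filter_sublist
  · have h4 := List.IsPrefix.filter
      (fun f : MvPolynomial (Fin n) K => decide (∀ t ∈ f.support, t ∈ termsUpTo n d)) h2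
    rw [List.filter_eq_self.mpr] at h4
    · convert h4
      rw [basisExtension]
    · intro v hv
      simpa using mem_termSpan_iff.mp (hL (Submodule.subset_span hv))
  · rw [← h3]
    exact Submodule.span_mono fun f hf => (mem_basisExtension.mp hf).1
  · exact Submodule.span_le.mpr fun f hf => (mem_basisExtension.mp hf).2
  · rintro f ⟨hf, hfL⟩
    by_cases hf0 : f = 0
    · rw [hf0]; exact zero_mem _
    · have hf' : f ∈ listSpan (gaussExtend m V C) := h3 ▸ hf
      refine Submodule.span_mono ?_ (h1.degree_of_mem_listSpan hf' hf0).2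
      rintro v ⟨hv, hle⟩
      refine mem_basisExtension.mpr ⟨hv, mem_termSpan_termsUpTo hm ?_⟩
      refine le_trans ?_ (degree_degree_le (m := m) hfL)
      by_contra! hlt
      exact absurd hle (not_le.mpr (hm _ _ hlt))

/-! ### The complement of the generator space -/

lemma reduceBy_mem_tentative {V : List (MvPolynomial (Fin n) K)} (hV : Triangular m V)
    {L : Set (Term n)} (hL : listSpan V ≤ termSpan K L) {f : MvPolynomial (Fin n) K}
    (hf : f ∈ termSpan K L) :
    reduceBy m V f ∈ termSpan K (tentativeOrderIdeal m L V) := by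
  have h : reduceBy m V f ∈ termSpan K L := by
    rw [← sub_sub_cancel f (reduceBy m V f)]
    exact sub_mem hf (hL (sub_reduceBy_mem _ _))
  refine mem_termSpan_iff.mpr fun t ht => ⟨mem_termSpan_iff.mp h t ht, ?_⟩
  rintro v hv rfl
  exact mem_support_iff.mp ht (coeff_degree_reduceBy hV f v hv)

lemma disjoint_listSpan_tentative {V : List (MvPolynomial (Fin n) K)} (hV : Triangular m V)
    (L : Set (Term n)) :
    Disjoint (listSpan V) (termSpan K (tentativeOrderIdeal m L V)) := by
  rw [Submodule.disjoint_def]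
  intro f hf hfO
  by_contra hf0
  obtain ⟨⟨v, hv, e⟩, -⟩ := hV.degree_of_mem_listSpan hf hf0
  exact (mem_termSpan_iff.mp hfO _ (m.degree_mem_support hf0)).2 v hv e

/-! ### Generator spaces that are closed under full expansion -/

lemma X_mul_mem_fullExpansion {V : List (MvPolynomial (Fin n) K)} {f : MvPolynomial (Fin n) K}
    (hf : f ∈ listSpan V) (j : Fin n) : X j * f ∈ listSpan (fullExpansion V) := by
  induction hf using Submodule.span_induction with
  | mem x hx =>
    refine Submodule.subset_span ?_
    simp only [fullExpansion, Set.mem_ofPred_eq, List.mem_flatMap, List.mem_map]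
    exact ⟨x, hx, j, List.mem_finRange j, rfl⟩
  | zero => simp
  | add x y _ _ hx hy => rw [mul_add]; exact add_mem hx hy
  | smul a x _ hx => rw [mul_smul_comm]; exact Submodule.smul_mem _ _ hx

/-- The full expansion of `V` yields no new polynomial with terms of degree at most `d`. -/
def ClosedUpTo (V : List (MvPolynomial (Fin n) K)) (d : ℕ) : Prop :=
  listSpan (fullExpansion V) ⊓ termSpan K (termsUpTo n d) ≤ listSpan V

lemma exists_eq_single_add {a : Term n} (ha : a ≠ 0) :
    ∃ (j : Fin n) (b : Term n), a = Finsupp.single j 1 + b := by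
  obtain ⟨j, hj⟩ := Finsupp.ne_iff.mp ha
  refine ⟨j, a - Finsupp.single j 1, (add_tsub_cancel_of_le ?_).symm⟩
  rw [Finsupp.single_le_iff]
  exact Nat.one_le_iff_ne_zero.mpr hj

lemma monomial_single_add (j : Fin n) (b : Term n) :
    monomial (Finsupp.single j 1 + b) (1 : K) = X j * monomial b 1 := by
  rw [X, monomial_mul, one_mul]

lemma X_mul_mem_termSpan {f : MvPolynomial (Fin n) K} {d : ℕ}
    (hf : f ∈ termSpan K (termsUpTo n d)) (j : Fin n) :
    X j * f ∈ termSpan K (termsUpTo n (1 + d)) :=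
  mul_mem_termSpan (monomial_mem_termSpan (by simp [termsUpTo])) hf

/-- Multiply by one indeterminate at a time; every intermediate product has degree at most `d`, so
stability applies at each stage. -/
lemma ClosedUpTo.monomial_mul_mem {V : List (MvPolynomial (Fin n) K)} {d : ℕ}
    (hc : ClosedUpTo V d) {f : MvPolynomial (Fin n) K} (hf : f ∈ listSpan V) {e : ℕ}
    (he : f ∈ termSpan K (termsUpTo n e)) (N : ℕ) (a : Term n) (ha : a.degree = N)
    (hN : N + e ≤ d) : monomial a 1 * f ∈ listSpan V := by
  induction N generalizing a with
  | zero =>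
    rw [(Finsupp.degree_eq_zero_iff a).mp ha]
    simpa using hf
  | succ N ih =>
    obtain ⟨j, b, rfl⟩ := exists_eq_single_add (a := a) (by rintro rfl; simp at ha)
    have hb : b.degree = N := by
      rw [map_add, Finsupp.degree_single] at ha
      omega
    rw [monomial_single_add, mul_assoc]
    refine hc ⟨X_mul_mem_fullExpansion (ih b hb (by omega)) j, ?_⟩
    refine termSpan_termsUpTo_mono (d := 1 + (N + e)) (by omega) (X_mul_mem_termSpan ?_ j)
    exact mul_mem_termSpan (monomial_mem_termSpan hb.le) he

lemma ClosedUpTo.mul_mem {V : List (MvPolynomial (Fin n) K)} {d : ℕ}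
    (hc : ClosedUpTo V d) {p f : MvPolynomial (Fin n) K} (hf : f ∈ listSpan V) {a e : ℕ}
    (he : f ∈ termSpan K (termsUpTo n e)) (hp : p ∈ termSpan K (termsUpTo n a))
    (hd : a + e ≤ d) : p * f ∈ listSpan V := by
  induction hp using Submodule.span_induction with
  | mem x hx =>
    obtain ⟨t, ht, rfl⟩ := hx
    have ht : t.degree ≤ a := ht
    exact hc.monomial_mul_mem hf he _ t rfl (by omega)
  | zero => simp
  | add x y _ _ hx hy => rw [add_mul]; exact add_mem hx hy
  | smul a x _ hx => rw [smul_mul_assoc]; exact Submodule.smul_mem _ _ hx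

/-- Multiples of degree at most `d` of leading terms are leading terms. -/
lemma ClosedUpTo.exists_degree_eq (hm : DegreeCompatible m)
    {V : List (MvPolynomial (Fin n) K)} (hV : Triangular m V) {d : ℕ} (hc : ClosedUpTo V d)
    {g : MvPolynomial (Fin n) K} (hg : g ∈ listSpan V) (hg0 : g ≠ 0) {o : Term n}
    (ho : m.degree g ≤ o) (hd : o.degree ≤ d) : ∃ v ∈ V, m.degree v = o := by
  have hsum : (o - m.degree g) + m.degree g = o := tsub_add_cancel_of_le ho
  have hmon : monomial (o - m.degree g) (1 : K) ≠ 0 := by simp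
  have hdeg : m.degree (monomial (o - m.degree g) (1 : K) * g) = o := by
    classical
    rw [m.degree_mul hmon hg0, m.degree_monomial, if_neg one_ne_zero, hsum]
  have hmem : monomial (o - m.degree g) (1 : K) * g ∈ listSpan V := by
    refine hc.monomial_mul_mem hg (mem_termSpan_termsUpTo hm le_rfl) _ _ rfl ?_
    rw [← map_add, hsum]
    exact hd
  rw [← hdeg]
  exact (hV.degree_of_mem_listSpan hmem (mul_ne_zero hmon hg0)).1

lemma ClosedUpTo.isOrderIdeal_tentative (hm : DegreeCompatible m)
    {V : List (MvPolynomial (Fin n) K)} (hV : Triangular m V) {d : ℕ} (hc : ClosedUpTo V d) :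
    IsOrderIdeal (tentativeOrderIdeal m (termsUpTo n d) V) := by
  refine ⟨(Finsupp.finite_of_degree_le d).subset fun t ht => ht.1, fun o ho t hto => ?_⟩
  have hod : o.degree ≤ d := ho.1
  refine ⟨(Finsupp.degree_mono hto).trans hod, ?_⟩
  rintro v hv rfl
  obtain ⟨w, hw, e⟩ := hc.exists_degree_eq hm hV (Submodule.subset_span hv) (hV.1 v hv) hto hod
  exact ho.2 w hw e

/-! ### The border basis check succeeds in high degrees -/

lemma exists_bound_mem_listSpan (F : List (MvPolynomial (Fin n) K))
    {g : MvPolynomial (Fin n) K} (hg : g ∈ Ideal.span {f | f ∈ F}) :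
    ∃ e, ∀ d ≥ e, ∀ V : List (MvPolynomial (Fin n) K), listSpan F ≤ listSpan V →
      ClosedUpTo V d → g ∈ listSpan V := by
  induction hg using Submodule.span_induction with
  | mem x hx => exact ⟨0, fun d _ V hV _ => hV (Submodule.subset_span hx)⟩
  | zero => exact ⟨0, fun d _ V _ _ => zero_mem _⟩
  | add x y _ _ hx hy =>
    obtain ⟨a, ha⟩ := hx
    obtain ⟨b, hb⟩ := hy
    refine ⟨max a b, fun d hd V hV hc => add_mem (ha d ?_ V hV hc) (hb d ?_ V hV hc)⟩
    exacts [(le_max_left _ _).trans hd, (le_max_right _ _).trans hd]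
  | smul p x _ hx =>
    obtain ⟨a, ha⟩ := hx
    obtain ⟨b, hb⟩ := exists_mem_termSpan p
    obtain ⟨c, hc⟩ := exists_mem_termSpan x
    refine ⟨max a (b + c), fun d hd V hV hcl => ?_⟩
    exact hcl.mul_mem (ha d ((le_max_left _ _).trans hd) V hV hcl) hc hb
      ((le_max_right _ _).trans hd)

lemma exists_le_degree_eq (o : Term n) (k : ℕ) (h : k ≤ o.degree) :
    ∃ t ≤ o, t.degree = k := by
  induction k with
  | zero => exact ⟨0, zero_le, by simp⟩
  | succ k ih =>
    obtain ⟨t, hto, ht⟩ := ih (by omega)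
    have hsum : t + (o - t) = o := add_tsub_cancel_of_le hto
    obtain ⟨j, b, hb⟩ := exists_eq_single_add (a := o - t) (by
      intro h0
      rw [h0, add_zero] at hsum
      subst hsum
      omega)
    refine ⟨t + Finsupp.single j 1, ?_, by simp [ht]⟩
    rw [← hsum, hb]
    exact add_le_add_right (le_add_of_nonneg_right zero_le) _

lemma exists_bound_borderBasisCheck (hm : DegreeCompatible m)
    (F : List (MvPolynomial (Fin n) K)) (hF : IsZeroDimensional m (Ideal.span {f | f ∈ F})) :
    ∃ e, ∀ d ≥ e, ∀ V : List (MvPolynomial (Fin n) K), Triangular m V →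
      listSpan F ≤ listSpan V → ClosedUpTo V d → BorderBasisCheck m (termsUpTo n d) V := by
  -- `D` bounds the degrees of the finitely many terms outside `LT(I)`; hence every term of degree
  -- `D + 1` is a leading term of `I`, and there are finitely many of these to realize in `⟨V⟩`.
  obtain ⟨D, hD⟩ := (Set.Finite.image Finsupp.degree hF).bddAbove
  have hT : ∀ t : Term n, t.degree = D + 1 → ∃ e, ∀ d ≥ e,
      ∀ V : List (MvPolynomial (Fin n) K), listSpan F ≤ listSpan V → ClosedUpTo V d →
        ∃ g ∈ listSpan V, g ≠ 0 ∧ m.degree g = t := by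
    intro t ht
    have : ∃ f ∈ Ideal.span {f | f ∈ F}, f ≠ 0 ∧ m.degree f = t := by
      by_contra h
      have := hD ⟨t, h, rfl⟩
      omega
    obtain ⟨g, hg, hg0, e⟩ := this
    obtain ⟨a, ha⟩ := exists_bound_mem_listSpan F hg
    exact ⟨a, fun d hd V hV hc => ⟨g, ha d hd V hV hc, hg0, e⟩⟩
  choose! e he using hT
  have hfin : {t : Term n | t.degree = D + 1}.Finite :=
    (Finsupp.finite_of_degree_le (D + 1)).subset fun t ht => le_of_eq ht
  refine ⟨max (D + 1) (hfin.toFinset.sup e), fun d hd V hV hFV hc => ?_⟩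
  rintro t ⟨⟨j, o, ho, rfl⟩, -⟩
  have hdD : D + 1 ≤ d := (le_max_left _ _).trans hd
  -- Otherwise `o` has a divisor of degree `D + 1`. That divisor is a leading term of `⟨V⟩`, hence
  -- so is its multiple `o`, which contradicts `o ∈ O`.
  have hoD : o.degree ≤ D := by
    by_contra! hlt
    obtain ⟨t, hto, ht⟩ := exists_le_degree_eq o (D + 1) hlt
    have hte : e t ≤ d := le_trans (Finset.le_sup (f := e) (hfin.mem_toFinset.mpr ht))
      ((le_max_right _ _).trans hd)
    obtain ⟨g, hg, hg0, rfl⟩ := he t ht d hte V hFV hc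
    obtain ⟨v, hv, e'⟩ := hc.exists_degree_eq hm hV hg hg0 hto ho.1
    exact ho.2 v hv e'
  change (o + Finsupp.single j 1).degree ≤ d
  rw [map_add, Finsupp.degree_single]
  omega

/-! ### Commuting multiplication maps -/

/-- Evaluation needs a commutative target: the subalgebra generated by the commuting elements. -/
lemma exists_algHom_of_commute {A : Type*} [Ring A] [Algebra K A] (M : Fin n → A)
    (h : ∀ i j, M i * M j = M j * M i) :
    ∃ φ : MvPolynomial (Fin n) K →ₐ[K] A, ∀ j, φ (X j) = M j := by
  let S := Algebra.adjoin K (Set.range M)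
  have : IsMulCommutative S := Algebra.isMulCommutative_adjoin K (s := Set.range M) (by
    rintro _ ⟨i, rfl⟩ _ ⟨j, rfl⟩
    exact h i j)
  let : CommRing S := inferInstance
  refine ⟨S.val.comp (aeval fun j => (⟨M j, Algebra.subset_adjoin ⟨j, rfl⟩⟩ : S)), fun j => ?_⟩
  change S.val (aeval _ (X j)) = M j
  rw [aeval_X]
  rfl

/-- If `⟨L⟩ = W ⊕ S` and `W` is stable under multiplication by the indeterminates within `⟨L⟩`,
the ideal generated by `W` meets `S` trivially. -/
lemma disjoint_ideal_span {d : ℕ} {W W' S : Submodule K (MvPolynomial (Fin n) K)}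
    (hsup : W ⊔ S = termSpan K (termsUpTo n d)) (hdisj : Disjoint W S)
    (h1 : (1 : MvPolynomial (Fin n) K) ∈ S)
    (hS : ∀ j, ∀ s ∈ S, X j * s ∈ termSpan K (termsUpTo n d))
    (hX : ∀ j, ∀ w ∈ W, X j * w ∈ W') (hW : W' ⊓ termSpan K (termsUpTo n d) ≤ W)
    {f : MvPolynomial (Fin n) K} (hf : f ∈ Ideal.span (W : Set (MvPolynomial (Fin n) K)))
    (hfS : f ∈ S) : f = 0 := by
  set U := termSpan K (termsUpTo n d) with hU
  have hWU : W ≤ U := hsup ▸ le_sup_left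
  have hSU : S ≤ U := hsup ▸ le_sup_right
  -- Enlarging `W` to a complement of `S` in all of `K[X]` makes the projection total; on `U` it is
  -- still the projection along `W`.
  obtain ⟨Q, hWQ, hQ⟩ := hdisj.exists_isCompl
  let P : MvPolynomial (Fin n) K →ₗ[K] S := S.projectionOnto Q hQ.symm
  have hPS : ∀ s : S, P s = s := fun s => Submodule.projectionOnto_apply_left hQ.symm s
  have hPW : ∀ w ∈ W, P w = 0 := fun w hw =>
    (Submodule.projectionOnto_apply_eq_zero_iff hQ.symm).mpr (hWQ hw)
  have hPU : ∀ f ∈ U, f - P f ∈ W := by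
    intro f hf
    rw [← hsup] at hf
    obtain ⟨w, hw, s, hs, rfl⟩ := Submodule.mem_sup.mp hf
    rw [map_add, hPW w hw, zero_add, hPS ⟨s, hs⟩]
    simpa using hw
  let M : Fin n → Module.End K S := fun j => P ∘ₗ LinearMap.mulLeft K (X j) ∘ₗ S.subtype
  have hM : ∀ j s, M j s = P (X j * (s : MvPolynomial (Fin n) K)) := fun _ _ => rfl
  have hcomm : ∀ i j, M i * M j = M j * M i := by
    intro i j
    ext1 s
    rw [Module.End.mul_apply, Module.End.mul_apply, hM i, hM j, hM, hM, ← sub_eq_zero, ← map_sub]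
    refine hPW _ (hW ⟨?_, sub_mem (hS _ _ (P _).2) (hS _ _ (P _).2)⟩)
    -- The products `x_i x_j s` may leave `U`, but they cancel. What remains lies in `W'` as a
    -- combination of multiples of elements of `W`, and in `U` by the left-hand form, so it lies in
    -- `W`.
    have e : X i * (P (X j * s.1) : MvPolynomial (Fin n) K) - X j * (P (X i * s.1)).1 =
        X j * (X i * s.1 - (P (X i * s.1)).1) - X i * (X j * s.1 - (P (X j * s.1)).1) := by ring
    rw [e]
    exact sub_mem (hX _ _ (hPU _ (hS _ _ s.2))) (hX _ _ (hPU _ (hS _ _ s.2)))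
  obtain ⟨φ, hφ⟩ := exists_algHom_of_commute (K := K) M hcomm
  have hmon : ∀ N, ∀ t : Term n, t.degree = N → N ≤ d →
      φ (monomial t 1) ⟨1, h1⟩ = P (monomial t 1) := by
    intro N
    induction N with
    | zero =>
      intro t ht _
      rw [(Finsupp.degree_eq_zero_iff t).mp ht, monomial_zero', map_one, map_one,
        Module.End.one_apply]
      exact (hPS ⟨1, h1⟩).symm
    | succ N ih =>
      intro t ht hN
      obtain ⟨j, b, rfl⟩ := exists_eq_single_add (a := t) (by rintro rfl; simp at ht)
      have hb : b.degree = N := by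
        rw [map_add, Finsupp.degree_single] at ht
        omega
      have hbU : monomial b (1 : K) ∈ U :=
        monomial_mem_termSpan (show b.degree ≤ d by omega)
      have htU : X j * monomial b (1 : K) ∈ U := by
        rw [← monomial_single_add]
        exact monomial_mem_termSpan (show Finsupp.degree _ ≤ d by omega)
      rw [monomial_single_add, map_mul, Module.End.mul_apply, ih b hb (by omega), hφ, hM, eq_comm,
        ← sub_eq_zero, ← map_sub]
      refine hPW _ (hW ⟨?_, sub_mem htU (hS _ _ (P _).2)⟩)
      rw [← mul_sub]
      exact hX _ _ (hPU _ hbU)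
  have hΦ : ∀ f ∈ U, φ f ⟨1, h1⟩ = P f := by
    intro f hf
    induction hf using Submodule.span_induction with
    | mem x hx =>
      obtain ⟨t, ht, rfl⟩ := hx
      exact hmon _ t rfl ht
    | zero => simp
    | add x y _ _ hx hy => rw [map_add, map_add, LinearMap.add_apply, hx, hy]
    | smul a x _ hx => rw [map_smul, map_smul, LinearMap.smul_apply, hx]
  have hker : ∀ f ∈ Ideal.span (W : Set (MvPolynomial (Fin n) K)), φ f ⟨1, h1⟩ = 0 := by
    intro f hf
    induction hf using Submodule.span_induction with
    | mem x hx => rw [hΦ x (hWU hx), hPW x hx]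
    | zero => simp
    | add x y _ _ hx hy => rw [map_add, LinearMap.add_apply, hx, hy, add_zero]
    | smul a x _ hx => rw [smul_eq_mul, map_mul, Module.End.mul_apply, hx, map_zero]
  have hf0 := hker f hf
  rw [hΦ f (hSU hfS), hPS ⟨f, hfS⟩] at hf0
  exact congrArg Subtype.val hf0

/-! ### Border prebases -/

/-- The sum contains `1` and is stable under each `x_j`: a product `x_j t` with `t ∈ O` is in `O` or
is a border term `b`, and `b` is congruent modulo `g b` to an element of `⟨O⟩`. -/
lemma IsBorderPrebasis.sup_eq_top {O : Set (Term n)} {G : Set (MvPolynomial (Fin n) K)}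
    (h : IsBorderPrebasis O G) (h0 : (0 : Term n) ∈ O) :
    (Ideal.span G).restrictScalars K ⊔ termSpan K O = ⊤ := by
  obtain ⟨g, hg, rfl⟩ := h
  set T := (Ideal.span (g '' border O)).restrictScalars K ⊔ termSpan K O with hT
  have hO : ∀ f ∈ termSpan K O, ∀ j, f * X j ∈ T := by
    intro f hf j
    induction hf using Submodule.span_induction with
    | mem x hx =>
      obtain ⟨t, ht, rfl⟩ := hx
      have e : monomial t (1 : K) * X j = monomial (t + Finsupp.single j 1) 1 := by
        rw [X, monomial_mul, one_mul]
      change monomial t (1 : K) * X j ∈ T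
      rw [e]
      by_cases hb : t + Finsupp.single j 1 ∈ O
      · exact Submodule.mem_sup_right (monomial_mem_termSpan hb)
      · have hb' : t + Finsupp.single j 1 ∈ border O := ⟨⟨j, t, ht, rfl⟩, hb⟩
        rw [← add_sub_cancel (g (t + Finsupp.single j 1))
          (monomial (t + Finsupp.single j 1) (1 : K))]
        exact Submodule.add_mem_sup (Ideal.subset_span ⟨_, hb', rfl⟩) (hg _ hb')
    | zero => simp
    | add x y _ _ hx hy => rw [add_mul]; exact add_mem hx hy
    | smul a x _ hx => rw [smul_mul_assoc]; exact Submodule.smul_mem _ _ hx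
  refine eq_top_iff.mpr fun f _ => ?_
  induction f using MvPolynomial.induction_on with
  | C a =>
    rw [← mul_one (C a), ← smul_eq_C_mul]
    exact Submodule.smul_mem _ _ (Submodule.mem_sup_right (monomial_mem_termSpan h0))
  | add p q hp hq => exact add_mem (hp trivial) (hq trivial)
  | mul_X p j hp =>
    obtain ⟨a, ha, b, hb, rfl⟩ := Submodule.mem_sup.mp (hp trivial)
    rw [add_mul]
    exact add_mem (Submodule.mem_sup_left (Ideal.mul_mem_right _ _ ha)) (hO b hb j)

/-! ### Interreduction -/

/-- The leading coefficients are `1`, and no leading term of the list occurs in another member. -/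
def Interreduced (m : MonomialOrder (Fin n)) (R : List (MvPolynomial (Fin n) K)) : Prop :=
  (∀ r ∈ R, coeff (m.degree r) r = 1) ∧
    R.Pairwise fun r s => coeff (m.degree r) s = 0 ∧ coeff (m.degree s) r = 0

lemma Interreduced.ne_zero {R : List (MvPolynomial (Fin n) K)} (hR : Interreduced m R) :
    ∀ r ∈ R, r ≠ 0 := by
  rintro r hr rfl
  simpa using hR.1 0 hr

lemma Interreduced.triangular {R : List (MvPolynomial (Fin n) K)} (hR : Interreduced m R) :
    Triangular m R := by
  refine ⟨hR.ne_zero, hR.2.imp_of_mem fun hr _ h e => ?_⟩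
  have h2 := h.2
  rw [← e, hR.1 _ hr] at h2
  exact one_ne_zero h2

lemma Interreduced.coeff_eq_zero {R : List (MvPolynomial (Fin n) K)} (hR : Interreduced m R)
    {r s : MvPolynomial (Fin n) K} (hr : r ∈ R) (hs : s ∈ R) (h : r ≠ s) :
    coeff (m.degree r) s = 0 := by
  have : Std.Symm fun r s : MvPolynomial (Fin n) K =>
      coeff (m.degree r) s = 0 ∧ coeff (m.degree s) r = 0 := ⟨fun _ _ h => h.symm⟩
  exact (hR.2.forall hr hs h).1

/-- All earlier leading terms are smaller, so elimination leaves the leading term of `v` intact, and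
the earlier polynomials cannot contain it. -/
lemma Interreduced.append {R : List (MvPolynomial (Fin n) K)} (hR : Interreduced m R)
    {v : MvPolynomial (Fin n) K} (hv0 : v ≠ 0)
    (hv : ∀ r ∈ R, m.toSyn (m.degree r) < m.toSyn (m.degree v)) :
    Interreduced m (R ++ [normalize m (R.foldl (eliminate m) v)]) ∧
      m.degree (normalize m (R.foldl (eliminate m) v)) = m.degree v := by
  set w := R.foldl (eliminate m) v with hw
  have hsub : v - w ∈ listSpan R := sub_foldl_eliminate_mem R v
  have hdeg : m.degree w = m.degree v := by
    by_cases h : v - w = 0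
    · rw [← sub_eq_zero.mp h]
    · obtain ⟨⟨r, hr, e⟩, -⟩ := hR.triangular.degree_of_mem_listSpan hsub h
      rw [← sub_sub_cancel v w]
      exact m.degree_sub_of_lt (e ▸ hv r hr)
  have hcw : coeff (m.degree v) w ≠ 0 := by
    rw [hw, coeff_foldl_eliminate _ _ fun r hr => m.coeff_eq_zero_of_lt (hv r hr)]
    exact m.coeff_degree_ne_zero_iff.mpr hv0
  have hlc : m.leadingCoeff w ≠ 0 := by
    change coeff (m.degree w) w ≠ 0
    rwa [hdeg]
  have hdeg' : m.degree (normalize m w) = m.degree v := (degree_normalize w).trans hdeg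
  refine ⟨⟨?_, ?_⟩, hdeg'⟩
  · intro r hr
    rcases List.mem_append.mp hr with hr | hr
    · exact hR.1 r hr
    · rw [List.mem_singleton.mp hr, degree_normalize, coeff_normalize]
      exact inv_mul_cancel₀ hlc
  · rw [List.pairwise_append]
    refine ⟨hR.2, List.pairwise_singleton _ _, fun r hr s hs => ?_⟩
    rw [List.mem_singleton.mp hs, coeff_normalize, hdeg']
    refine ⟨?_, m.coeff_eq_zero_of_lt (hv r hr)⟩
    rw [coeff_degree_foldl_eliminate R hR.ne_zero (hR.2.imp fun h => h.1) v r hr, mul_zero]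

lemma foldl_interreduce (l R : List (MvPolynomial (Fin n) K)) (hR : Interreduced m R)
    (hl0 : ∀ v ∈ l, v ≠ 0)
    (hl : l.Pairwise fun v w => m.toSyn (m.degree v) < m.toSyn (m.degree w))
    (hRl : ∀ r ∈ R, ∀ v ∈ l, m.toSyn (m.degree r) < m.toSyn (m.degree v)) :
    Interreduced m (l.foldl (fun R v => R ++ [normalize m (R.foldl (eliminate m) v)]) R) ∧
      listSpan (l.foldl (fun R v => R ++ [normalize m (R.foldl (eliminate m) v)]) R) =
        listSpan R ⊔ listSpan l := by
  induction l generalizing R with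
  | nil => exact ⟨hR, by simp [listSpan]⟩
  | cons v l ih =>
    rw [List.pairwise_cons] at hl
    obtain ⟨h1, h2⟩ := hR.append (hl0 v List.mem_cons_self)
      fun r hr => hRl r hr v List.mem_cons_self
    obtain ⟨i1, i2⟩ := ih _ h1 (fun w hw => hl0 w (List.mem_cons_of_mem _ hw)) hl.2 (by
      intro r hr w hw
      rcases List.mem_append.mp hr with hr | hr
      · exact hRl r hr w (List.mem_cons_of_mem _ hw)
      · rw [List.mem_singleton.mp hr, h2]
        exact hl.1 w hw)
    refine ⟨i1, i2.trans ?_⟩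
    rw [listSpan_append, listSpan_singleton, span_normalize, listSpan_cons, ← sup_assoc,
      sup_span_eq_of_sub_mem (sub_foldl_eliminate_mem R v)]

lemma interreduce_spec {V : List (MvPolynomial (Fin n) K)} (hV : Triangular m V) :
    Interreduced m (interreduce m V) ∧ listSpan (interreduce m V) = listSpan V := by
  obtain ⟨h1, h2⟩ := foldl_interreduce (m := m) (sortAsc m V) [] ⟨by simp, List.Pairwise.nil⟩
    (hV.perm (sortAsc_perm V).symm).1 hV.sortAsc_pairwise (by simp)
  refine ⟨h1, h2.trans ?_⟩
  rw [listSpan_perm (sortAsc_perm V)]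
  simp [listSpan]

lemma Triangular.exists_degree_eq_of_le {V W : List (MvPolynomial (Fin n) K)}
    (hV : Triangular m V) (hW : Triangular m W) (h : listSpan V ≤ listSpan W)
    {v : MvPolynomial (Fin n) K} (hv : v ∈ V) : ∃ w ∈ W, m.degree w = m.degree v :=
  (hW.degree_of_mem_listSpan (h (Submodule.subset_span hv)) (hV.1 v hv)).1

lemma mem_finalReduction {V : List (MvPolynomial (Fin n) K)} {L : Set (Term n)}
    {g : MvPolynomial (Fin n) K} :
    g ∈ finalReduction m V L ↔
      g ∈ interreduce m V ∧ m.degree g ∈ border (tentativeOrderIdeal m L V) := by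
  simp [finalReduction]

/-- A border term lies in `L` but not in `O`, so it is a leading term of `V`. After interreduction
the tail of its polynomial avoids all of `LT(V)`, hence lies in `⟨O⟩`. -/
lemma isBorderPrebasis_finalReduction {V : List (MvPolynomial (Fin n) K)}
    (hV : Triangular m V) {L : Set (Term n)} (hL : listSpan V ≤ termSpan K L)
    (hcheck : BorderBasisCheck m L V) :
    IsBorderPrebasis (tentativeOrderIdeal m L V) {g | g ∈ finalReduction m V L} := by
  obtain ⟨hR, hspan⟩ := interreduce_spec hV
  have hex : ∀ b ∈ border (tentativeOrderIdeal m L V), ∃ r ∈ interreduce m V, m.degree r = b := by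
    intro b hb
    have hbV : ∃ v ∈ V, m.degree v = b := by
      by_contra! h
      exact hb.2 ⟨hcheck hb, h⟩
    obtain ⟨v, hv, rfl⟩ := hbV
    exact hV.exists_degree_eq_of_le hR.triangular hspan.ge hv
  choose! g hg hgb using hex
  refine ⟨g, fun b hb => mem_termSpan_iff.mpr fun t ht => ?_, ?_⟩
  · have hmem : monomial b (1 : K) - g b ∈ termSpan K L :=
      sub_mem (monomial_mem_termSpan (hcheck hb))
        (hL (hspan ▸ Submodule.subset_span (hg b hb)))
    refine ⟨mem_termSpan_iff.mp hmem t ht, ?_⟩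
    rintro v hv rfl
    obtain ⟨r, hr, e⟩ := hV.exists_degree_eq_of_le hR.triangular hspan.ge hv
    rw [← e] at ht
    refine mem_support_iff.mp ht ?_
    classical
    rw [coeff_sub, coeff_monomial]
    by_cases h : r = g b
    · rw [h, if_pos (hgb b hb).symm, hR.1 _ (hg b hb), sub_self]
    · rw [hR.coeff_eq_zero hr (hg b hb) h, sub_zero, if_neg]
      intro e'
      have h0 := hR.coeff_eq_zero hr (hg b hb) h
      rw [← e', ← (congrArg (coeff · (g b)) (hgb b hb)), hR.1 _ (hg b hb)] at h0
      exact one_ne_zero h0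
  · ext f
    simp only [Set.mem_ofPred_eq, mem_finalReduction, Set.mem_image]
    constructor
    · rintro ⟨hf, hb⟩
      refine ⟨_, hb, ?_⟩
      by_contra h
      have h0 := hR.coeff_eq_zero (hg _ hb) hf h
      rw [hgb _ hb, hR.1 f hf] at h0
      exact one_ne_zero h0
    · rintro ⟨b, hb, rfl⟩
      refine ⟨hg b hb, ?_⟩
      rwa [hgb b hb]

/-! ### The main loop -/

/-- The loop invariant for generators of the ideal `⟨F⟩`. -/
structure Invariant (m : MonomialOrder (Fin n)) (F : List (MvPolynomial (Fin n) K))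
    (s : State n K) : Prop where
  triangular : Triangular m s.V
  le_universe : listSpan s.V ≤ termSpan K (termsUpTo n s.d)
  span_le : listSpan F ≤ listSpan s.V
  le_ideal : listSpan s.V ≤ (Ideal.span {f | f ∈ F}).restrictScalars K

lemma invariant_initialState (F : List (MvPolynomial (Fin n) K)) :
    Invariant m F (initialState m F) := by
  obtain ⟨h1, h2⟩ := vectorSpaceBasis_spec (m := m) F
  refine ⟨h1, h2.le.trans ?_, h2.ge, h2.le.trans ?_⟩
  · refine Submodule.span_le.mpr fun f hf => mem_termSpan_iff.mpr fun t ht => ?_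
    have h3 : f.totalDegree ≤ (F.map MvPolynomial.totalDegree).foldr max 0 :=
      List.le_max_of_le' 0 (List.mem_map_of_mem hf) le_rfl
    refine le_trans ?_ h3
    exact le_totalDegree ht
  · exact Submodule.span_le.mpr fun f hf => Ideal.subset_span hf

lemma exists_mul_of_mem_candidates {A : Oracle n K} {k : ℕ} {s : State n K}
    {f : MvPolynomial (Fin n) K} (hf : f ∈ candidates m A k s) :
    ∃ (j : Fin n) (v : MvPolynomial (Fin n) K), v ∈ s.V ∧ f = X j * v := by
  unfold candidates at hf
  split_ifs at hf
  · simp only [selectCandidates, List.mem_flatMap, List.mem_map, List.mem_filter] at hf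
    obtain ⟨q, -, v, ⟨hv, -⟩, rfl⟩ := hf
    exact ⟨q.1, v, hv, rfl⟩
  · simp only [fullExpansion, List.mem_flatMap, List.mem_map] at hf
    obtain ⟨v, hv, j, -, rfl⟩ := hf
    exact ⟨j, v, hv, rfl⟩

lemma Invariant.basisExtension (hm : DegreeCompatible m) {F : List (MvPolynomial (Fin n) K)}
    {s : State n K} (hs : Invariant m F s) (A : Oracle n K) (k i c : ℕ) :
    Invariant m F ⟨i, c, s.d, basisExtension m s.V (candidates m A k s) (termsUpTo n s.d)⟩ := by
  obtain ⟨h1, h2, h3⟩ :=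
    basisExtension_spec hm hs.triangular (candidates m A k s) hs.le_universe
  refine ⟨h1, h3.le.trans inf_le_right, ?_, h3.le.trans (inf_le_left.trans ?_)⟩
  · exact hs.span_le.trans (Submodule.span_mono fun v hv => h2.subset hv)
  · refine sup_le hs.le_ideal (Submodule.span_le.mpr fun f hf => ?_)
    obtain ⟨j, v, hv, rfl⟩ := exists_mul_of_mem_candidates hf
    exact Ideal.mul_mem_left _ _ (hs.le_ideal (Submodule.subset_span hv))

lemma Invariant.closedUpTo (hm : DegreeCompatible m) {F : List (MvPolynomial (Fin n) K)}
    {s : State n K} (hs : Invariant m F s)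
    (h : OBBA.basisExtension m s.V (fullExpansion s.V) (termsUpTo n s.d) = s.V) :
    ClosedUpTo s.V s.d := by
  obtain ⟨-, -, h3⟩ :=
    basisExtension_spec hm hs.triangular (fullExpansion s.V) hs.le_universe
  rw [h] at h3
  exact (inf_le_inf_right _ le_sup_right).trans h3.ge

lemma candidates_of_not_usesOracle {A : Oracle n K} {k : ℕ} {s : State n K}
    (h : ¬ UsesOracle A k s) : candidates m A k s = fullExpansion s.V := if_neg h

lemma Invariant.length_le {F : List (MvPolynomial (Fin n) K)} {s : State n K}
    (hs : Invariant m F s) : s.V.length ≤ (termsUpTo n s.d).ncard := by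
  classical
  have hnd : (s.V.map m.degree).Nodup := List.pairwise_map.mpr hs.triangular.2
  rw [← List.length_map (f := m.degree), ← List.toFinset_card_of_nodup hnd,
    ← Set.ncard_coe_finset]
  refine Set.ncard_le_ncard ?_ (Finsupp.finite_of_degree_le s.d)
  intro t ht
  simp only [List.coe_toFinset, List.mem_map, Set.mem_ofPred_eq] at ht
  obtain ⟨v, hv, rfl⟩ := ht
  exact degree_degree_le (hs.le_universe (Submodule.subset_span hv))

/-- The termination measure: remaining oracle calls, remaining increases of the degree, remaining
leading terms. -/
def potential (k e : ℕ) (s : State n K) : ℕ ×ₗ ℕ ×ₗ ℕ :=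
  toLex (k - s.calls, toLex (e - s.d, (termsUpTo n s.d).ncard - s.V.length))

/-- An oracle iteration lowers the first component, whatever else changes. Without the oracle,
either `V` grows at fixed `d`, or `V` is stable and fails the check, which forces `d < e`; thus the
truncated difference `e - d` really drops. -/
lemma step_inl (hm : DegreeCompatible m) {F : List (MvPolynomial (Fin n) K)} {e : ℕ}
    (he : ∀ d ≥ e, ∀ V : List (MvPolynomial (Fin n) K), Triangular m V →
      listSpan F ≤ listSpan V → ClosedUpTo V d → BorderBasisCheck m (termsUpTo n d) V)
    {A : Oracle n K} {k : ℕ} {s s' : State n K} (hs : Invariant m F s)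
    (h : step m A k s = Sum.inl s') :
    Invariant m F s' ∧ potential k e s' < potential k e s := by
  have hs' := hs.basisExtension hm A k (s.iter + 1)
  have hlen : s.V <+: basisExtension m s.V (candidates m A k s) (termsUpTo n s.d) :=
    (basisExtension_spec hm hs.triangular _ hs.le_universe).2.1
  unfold step at h
  simp only at h
  by_cases h1 : basisExtension m s.V (candidates m A k s) (termsUpTo n s.d) = s.V
  · rw [if_neg (not_not.mpr h1)] at h
    by_cases h2 : BorderBasisCheck m (termsUpTo n s.d) s.V
    · rw [if_neg (not_not.mpr h2)] at h
      by_cases h3 : UsesOracle A k s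
      · rw [if_pos h3, if_pos h3] at h
        obtain rfl := Sum.inl.inj h
        refine ⟨⟨hs.triangular, hs.le_universe, hs.span_le, hs.le_ideal⟩, ?_⟩
        exact Prod.Lex.toLex_lt_toLex.mpr (Or.inl (Nat.sub_succ_lt_self _ _ h3.1))
      · rw [if_neg h3] at h
        cases h
    · rw [if_pos h2] at h
      obtain rfl := Sum.inl.inj h
      refine ⟨⟨hs.triangular, hs.le_universe.trans (termSpan_termsUpTo_mono (Nat.le_succ _)),
        hs.span_le, hs.le_ideal⟩, ?_⟩
      by_cases h3 : UsesOracle A k s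
      · rw [if_pos h3]
        exact Prod.Lex.toLex_lt_toLex.mpr (Or.inl (Nat.sub_succ_lt_self _ _ h3.1))
      · rw [if_neg h3]
        rw [candidates_of_not_usesOracle h3] at h1
        have hlt : s.d < e := by
          by_contra! hle
          exact h2 (he _ hle _ hs.triangular hs.span_le (hs.closedUpTo hm h1))
        refine Prod.Lex.toLex_lt_toLex.mpr (Or.inr ⟨rfl, Prod.Lex.toLex_lt_toLex.mpr (Or.inl ?_)⟩)
        exact Nat.sub_succ_lt_self _ _ hlt
  · rw [if_pos h1] at h
    obtain rfl := Sum.inl.inj h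
    refine ⟨hs' _, ?_⟩
    have hlt : s.V.length <
        (basisExtension m s.V (candidates m A k s) (termsUpTo n s.d)).length :=
      lt_of_le_of_ne hlen.length_le fun e => h1 (hlen.eq_of_length e).symm
    -- The new length is still at most the size of the universe, so truncated subtraction decreases
    -- strictly.
    have hle := (hs' 0).length_le
    have hlast : (termsUpTo n s.d).ncard -
          (basisExtension m s.V (candidates m A k s) (termsUpTo n s.d)).length <
        (termsUpTo n s.d).ncard - s.V.length := Nat.sub_lt_sub_left (hlt.trans_le hle) hlt
    by_cases h3 : UsesOracle A k s
    · rw [if_pos h3]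
      exact Prod.Lex.toLex_lt_toLex.mpr (Or.inl (Nat.sub_succ_lt_self _ _ h3.1))
    · rw [if_neg h3]
      exact Prod.Lex.toLex_lt_toLex.mpr (Or.inr ⟨rfl, Prod.Lex.toLex_lt_toLex.mpr (Or.inr ⟨rfl, hlast⟩)⟩)

lemma step_inr (hm : DegreeCompatible m) {F : List (MvPolynomial (Fin n) K)}
    {A : Oracle n K} {k : ℕ} {s : State n K} {G : List (MvPolynomial (Fin n) K)}
    (hs : Invariant m F s) (h : step m A k s = Sum.inr G) :
    ClosedUpTo s.V s.d ∧ BorderBasisCheck m (termsUpTo n s.d) s.V ∧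
      G = finalReduction m s.V (termsUpTo n s.d) := by
  unfold step at h
  simp only at h
  by_cases h1 : basisExtension m s.V (candidates m A k s) (termsUpTo n s.d) = s.V
  · rw [if_neg (not_not.mpr h1)] at h
    by_cases h2 : BorderBasisCheck m (termsUpTo n s.d) s.V
    · rw [if_neg (not_not.mpr h2)] at h
      by_cases h3 : UsesOracle A k s
      · rw [if_pos h3] at h
        cases h
      · rw [if_neg h3] at h
        rw [candidates_of_not_usesOracle h3] at h1
        exact ⟨hs.closedUpTo hm h1, h2, (Sum.inr.inj h).symm⟩
    · rw [if_pos h2] at h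
      cases h
  · rw [if_pos h1] at h
    cases h

lemma exists_runFor (hm : DegreeCompatible m) {F : List (MvPolynomial (Fin n) K)} {e : ℕ}
    (he : ∀ d ≥ e, ∀ V : List (MvPolynomial (Fin n) K), Triangular m V →
      listSpan F ≤ listSpan V → ClosedUpTo V d → BorderBasisCheck m (termsUpTo n d) V)
    (A : Oracle n K) (k : ℕ) (s : State n K) (hs : Invariant m F s) :
    ∃ N G, runFor m A k N s = some G := by
  induction hp : potential k e s using WellFoundedLT.induction generalizing s with
  | ind p ih =>
    rcases h : step m A k s with s' | G
    · obtain ⟨h1, h2⟩ := step_inl hm he hs h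
      obtain ⟨N, G, hN⟩ := ih _ (hp ▸ h2) s' h1 rfl
      exact ⟨N + 1, G, by simp only [runFor, h, hN]⟩
    · exact ⟨1, G, by simp only [runFor, h]⟩

lemma exists_step_of_runFor (hm : DegreeCompatible m) {F : List (MvPolynomial (Fin n) K)} {e : ℕ}
    (he : ∀ d ≥ e, ∀ V : List (MvPolynomial (Fin n) K), Triangular m V →
      listSpan F ≤ listSpan V → ClosedUpTo V d → BorderBasisCheck m (termsUpTo n d) V)
    {A : Oracle n K} {k N : ℕ} {s : State n K} (hs : Invariant m F s)
    {G : List (MvPolynomial (Fin n) K)} (h : runFor m A k N s = some G) :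
    ∃ s', Invariant m F s' ∧ step m A k s' = Sum.inr G := by
  induction N generalizing s with
  | zero => simp [runFor] at h
  | succ N ih =>
    rcases h' : step m A k s with s' | G'
    · simp only [runFor, h'] at h
      exact ih (step_inl hm he hs h').1 h
    · simp only [runFor, h', Option.some.injEq] at h
      exact ⟨s, hs, h ▸ h'⟩

/-! ### Correctness of the output -/

lemma isBorderBasis_finalReduction (hm : DegreeCompatible m)
    {F : List (MvPolynomial (Fin n) K)} {s : State n K} (hs : Invariant m F s)
    (hc : ClosedUpTo s.V s.d) (hcheck : BorderBasisCheck m (termsUpTo n s.d) s.V)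
    (hI : Ideal.span {f | f ∈ F} ≠ ⊤) :
    IsBorderBasis (tentativeOrderIdeal m (termsUpTo n s.d) s.V)
      {g | g ∈ finalReduction m s.V (termsUpTo n s.d)} (Ideal.span {f | f ∈ F}) := by
  set O := tentativeOrderIdeal m (termsUpTo n s.d) s.V with hO
  set I := Ideal.span {f | f ∈ F} with hIdef
  have hOI : IsOrderIdeal O := hc.isOrderIdeal_tentative hm hs.triangular
  have hpre := isBorderPrebasis_finalReduction hs.triangular hs.le_universe hcheck
  -- If `1` were a leading term of `V`, the ideal would contain a nonzero constant.
  have h0 : (0 : Term n) ∈ O := by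
    refine ⟨by simp [termsUpTo], fun v hv h => hI ?_⟩
    have hvI : v ∈ I := hs.le_ideal (Submodule.subset_span hv)
    have hv0 := hs.triangular.1 v hv
    rw [m.eq_C_of_degree_eq_zero h] at hvI
    exact Ideal.eq_top_of_isUnit_mem _ hvI
      ((isUnit_iff_ne_zero.mpr (m.leadingCoeff_ne_zero_iff.mpr hv0)).map C)
  have htop := hpre.sup_eq_top h0
  have hOL : termSpan K O ≤ termSpan K (termsUpTo n s.d) :=
    Submodule.span_mono (Set.image_mono fun t ht => ht.1)
  have hsup : listSpan s.V ⊔ termSpan K O = termSpan K (termsUpTo n s.d) := by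
    refine le_antisymm (sup_le hs.le_universe hOL) fun f hf => ?_
    rw [← sub_add_cancel f (reduceBy m s.V f)]
    exact Submodule.add_mem_sup (sub_reduceBy_mem _ _)
      (reduceBy_mem_tentative hs.triangular hs.le_universe hf)
  have hIV : I ≤ Ideal.span (listSpan s.V : Set (MvPolynomial (Fin n) K)) :=
    Ideal.span_mono fun f hf => hs.span_le (Submodule.subset_span hf)
  have hXO : ∀ j, ∀ f ∈ termSpan K O, X j * f ∈ termSpan K (termsUpTo n s.d) := by
    intro j f hf
    induction hf using Submodule.span_induction with
    | mem x hx =>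
      obtain ⟨t, ht, rfl⟩ := hx
      have e : X j * monomial t (1 : K) = monomial (t + Finsupp.single j 1) 1 := by
        rw [add_comm, monomial_single_add]
      change X j * monomial t (1 : K) ∈ _
      rw [e]
      refine monomial_mem_termSpan ?_
      by_cases hb : t + Finsupp.single j 1 ∈ O
      · exact hb.1
      · exact hcheck ⟨⟨j, t, ht, rfl⟩, hb⟩
    | zero => simp
    | add x y _ _ hx hy => rw [mul_add]; exact add_mem hx hy
    | smul a x _ hx => rw [mul_smul_comm]; exact Submodule.smul_mem _ _ hx
  have hdisj : ∀ f ∈ I, f ∈ termSpan K O → f = 0 := fun f hf hfO =>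
    disjoint_ideal_span hsup (disjoint_listSpan_tentative hs.triangular _)
      (monomial_mem_termSpan h0) hXO (fun j w hw => X_mul_mem_fullExpansion hw j) hc (hIV hf) hfO
  have hGI : Ideal.span {g | g ∈ finalReduction m s.V (termsUpTo n s.d)} ≤ I := by
    refine Ideal.span_le.mpr fun g hg => hs.le_ideal ?_
    rw [← (interreduce_spec hs.triangular).2]
    exact Submodule.subset_span (mem_finalReduction.mp hg).1
  refine ⟨hOI, hpre, le_antisymm hGI fun f hf => ?_, ?_, ?_⟩
  -- Split `f ∈ I` along `(G) + ⟨O⟩`; its second part lies in `I ∩ ⟨O⟩ = 0`.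
  · obtain ⟨a, ha, b, hb, rfl⟩ := Submodule.mem_sup.mp (htop.ge (Submodule.mem_top (x := f)))
    have hbI : b ∈ I := (Submodule.add_mem_iff_right I (hGI ha)).mp hf
    rw [hdisj b hbI hb, add_zero]
    exact ha
  · exact Submodule.disjoint_def.mpr hdisj
  · exact codisjoint_iff.mpr (top_le_iff.mp (htop.ge.trans
      (sup_le_sup_right (Submodule.restrictScalars_mono K hGI) _)))

end

end OBBA

/-! ### Termination and correctness combined -/

theorem mainTheorem4 {n : ℕ} {K : Type*} [Field K] (m : MonomialOrder (Fin n))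
    (hm : OBBA.DegreeCompatible m) (A : OBBA.Oracle n K) (k : ℕ)
    (F : List (MvPolynomial (Fin n) K))
    (hF : OBBA.IsZeroDimensional m (Ideal.span {f | f ∈ F})) :
    (∃ G, OBBA.Returns m A k F G) ∧
      ∀ G, OBBA.Returns m A k F G → Ideal.span {f | f ∈ F} ≠ ⊤ →
        ∃ O : Set (OBBA.Term n), OBBA.IsBorderBasis O {g | g ∈ G} (Ideal.span {f | f ∈ F}) := by
  obtain ⟨e, he⟩ := OBBA.exists_bound_borderBasisCheck hm F hF
  have h0 := OBBA.invariant_initialState (m := m) F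
  constructor
  · obtain ⟨N, G, hN⟩ := OBBA.exists_runFor hm he A k _ h0
    exact ⟨G, N, hN⟩
  · rintro G ⟨N, hN⟩ hI
    obtain ⟨s, hs, hstep⟩ := OBBA.exists_step_of_runFor hm he h0 hN
    obtain ⟨hc, hcheck, rfl⟩ := OBBA.step_inr hm hs hstep
    exact ⟨_, OBBA.isBorderBasis_finalReduction hm hs hc hcheck hI⟩
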